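/- Let $\alpha,\beta,\gamma>0$ and let $F_{\alpha,\beta}^{(\gamma)}(z)=\sum_{k=0}^{\infty}\frac{z^k}{[\Gamma(\alpha k+\beta)]^{\gamma}}$ be the Le Roy type function (the series converges for every $z\in\mathbb{C}$). Let $s\mapsto[\Gamma(-\alpha s+\beta)]^{\gamma}$ denote the holomorphic branch, in the complex $s$-plane cut along $[\beta/\alpha,+\infty)$, of the corresponding multi-valued function which is positive for negative real $s$. For $z\neq 0$ put $(-z)^{-s}=\exp\{-s[\log|z|+i\arg(-z)]\}$, where $\arg(-z)$ is an arbitrarily chosen value of $\operatorname{Arg}(-z)$. Let $\mathcal{L}_{-\infty}$ be a left loop, i.e. a piecewise $C^1$ curve situated in a horizontal strip, starting at $-\infty+i\varphi_1$ and terminating at $-\infty+i\varphi_2$, where $-\infty<\varphi_1<0<\varphi_2<+\infty$, and meeting the real line only at a point $c$ with $-1<c<0$. Then, for every $z\in\mathbb{C}\setminus\{0\}$, the integral below converges (as the limit of the integrals along bounded arcs of $\mathcal{L}_{-\infty}$ both of whose ends tend to infinity) and $$F_{\alpha,\beta}^{(\gamma)}(z)=\frac{1}{2\pi i}\int_{\mathcal{L}_{-\infty}}\frac{\Gamma(s)\Gamma(1-s)}{[\Gamma(-\alpha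 s+\beta)]^{\gamma}}\,(-z)^{-s}\,ds+\frac{1}{[\Gamma(\beta)]^{\gamma}}.$$ Moreover, $\frac{1}{2\pi i}$ times the integral equals the (convergent) sum of the residues of the integrand at $s=-1,-2,\dots$. -/

import Mathlib

open Filter Topology MeasureTheory

noncomputable section

namespace LeRoy

/-- The coefficient-times-power `z ^ k / [Γ(α k + β)] ^ γ` of the Le Roy type series. -/
def term (α β γ : ℝ) (z : ℂ) (k : ℕ) : ℂ :=
  z ^ k / ((Real.Gamma (α * k + β) ^ γ : ℝ) : ℂ)

/-- The Le Roy type function `F_{α,β}^{(γ)}(z) = ∑_{k ≥ 0} z ^ k / [Γ(α k + β)] ^ γ`. -/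
def F (α β γ : ℝ) (z : ℂ) : ℂ := ∑' k : ℕ, term α β γ z k

/-- The branch of `log Γ` on the plane cut along `(-∞, 0]` that is real on the positive axis: the
primitive, vanishing at `1`, of `Γ' / Γ`, written as an integral along the segment from `1` to `w`.
On the cut itself the value is irrelevant. -/
def logGamma (w : ℂ) : ℂ :=
  ∫ t in (0 : ℝ)..1, (w - 1) * Complex.digamma (1 + (t : ℂ) * (w - 1))

/-- The branch of the multi-valued function `[Γ(w)] ^ γ` on the plane cut along `(-∞, 0]` that is
positive on the positive axis. -/
def gammaPow (γ : ℝ) (w : ℂ) : ℂ := Complex.exp (γ * logGamma w)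

lemma gamma_ne_zero_of_mem_slitPlane {w : ℂ} (hw : w ∈ Complex.slitPlane) :
    ∀ m : ℕ, w ≠ -(m : ℂ) := by
  rintro m rfl
  rcases hw with h | h
  · simp at h
    have : (0 : ℝ) ≤ m := m.cast_nonneg
    linarith
  · simp at h

lemma segment_mem_slitPlane {w : ℂ} (hw : w ∈ Complex.slitPlane) {t : ℝ} (h0 : 0 ≤ t)
    (h1 : t ≤ 1) : 1 + (t : ℂ) * (w - 1) ∈ Complex.slitPlane := by
  have h := Complex.starConvex_one_slitPlane.add_smul_sub_mem hw h0 h1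
  simpa using h

lemma hasDerivAt_gamma {w : ℂ} (hw : w ∈ Complex.slitPlane) :
    HasDerivAt Complex.Gamma (Complex.Gamma w * Complex.digamma w) w := by
  have h := gamma_ne_zero_of_mem_slitPlane hw
  have hd := (Complex.differentiableAt_Gamma w h).hasDerivAt
  have e : Complex.Gamma w * Complex.digamma w = deriv Complex.Gamma w := by
    rw [Complex.digamma_def, logDeriv_apply, mul_div_cancel₀ _ (Complex.Gamma_ne_zero h)]
  rwa [e]

lemma continuousOn_digamma : ContinuousOn Complex.digamma Complex.slitPlane := by
  have hd : DifferentiableOn ℂ Complex.Gamma Complex.slitPlane := fun w hw =>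
    (hasDerivAt_gamma hw).differentiableAt.differentiableWithinAt
  have h1 := (hd.deriv Complex.isOpen_slitPlane).continuousOn
  exact h1.div hd.continuousOn fun w hw =>
    Complex.Gamma_ne_zero (gamma_ne_zero_of_mem_slitPlane hw)

/-- Any primitive of the digamma function along the segment computes `logGamma`. -/
lemma logGamma_eq_sub {w : ℂ} (hw : w ∈ Complex.slitPlane) {L : ℂ → ℂ}
    (hL : ∀ t : ℝ, 0 ≤ t → t ≤ 1 → HasDerivAt L
      (Complex.digamma (1 + (t : ℂ) * (w - 1))) (1 + (t : ℂ) * (w - 1))) :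
    logGamma w = L w - L 1 := by
  have key : ∀ t ∈ Set.uIcc (0 : ℝ) 1,
      HasDerivAt (fun t : ℝ => L (1 + (t : ℂ) * (w - 1)))
        ((w - 1) * Complex.digamma (1 + (t : ℂ) * (w - 1))) t := by
    intro t ht
    rw [Set.uIcc_of_le zero_le_one] at ht
    have h1 : HasDerivAt (fun t : ℝ => 1 + (t : ℂ) * (w - 1)) (w - 1) t := by
      simpa using ((Complex.ofRealCLM.hasDerivAt (x := t)).mul_const (w - 1)).const_add (1 : ℂ)
    have h2 := (hL t ht.1 ht.2).comp t h1
    rw [mul_comm]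
    exact h2
  have hc : IntervalIntegrable
      (fun t : ℝ => (w - 1) * Complex.digamma (1 + (t : ℂ) * (w - 1))) volume 0 1 := by
    apply ContinuousOn.intervalIntegrable
    apply continuousOn_const.mul
    refine continuousOn_digamma.comp (by fun_prop) ?_
    intro t ht
    rw [Set.uIcc_of_le zero_le_one] at ht
    exact segment_mem_slitPlane hw ht.1 ht.2
  have := intervalIntegral.integral_eq_sub_of_hasDerivAt key hc
  simpa [logGamma] using this

/-- There is a holomorphic logarithm of `Γ` on the cut plane. -/
lemma exists_log_gamma : ∃ L : ℂ → ℂ,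
    (∀ w ∈ Complex.slitPlane, Complex.exp (L w) = Complex.Gamma w) ∧
    ∀ w ∈ Complex.slitPlane, HasDerivAt L (Complex.digamma w) w := by
  have hsc : IsSimplyConnected Complex.slitPlane := by
    have : ContractibleSpace Complex.slitPlane :=
      Complex.starConvex_one_slitPlane.contractibleSpace ⟨1, Complex.one_mem_slitPlane⟩
    exact (inferInstance : SimplyConnectedSpace Complex.slitPlane)
  obtain ⟨L, hLc, hL⟩ := Complex.exists_continuousOn_eqOn_exp_comp hsc Complex.isOpen_slitPlane
    (g := Complex.Gamma)
    (fun w hw => (hasDerivAt_gamma hw).continuousAt.continuousWithinAt)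
    (by
      rintro ⟨w, hw, h⟩
      exact Complex.Gamma_ne_zero (gamma_ne_zero_of_mem_slitPlane hw) h)
  refine ⟨L, fun w hw => hL hw, fun w hw => ?_⟩
  have hne := Complex.Gamma_ne_zero (gamma_ne_zero_of_mem_slitPlane hw)
  have hev : Complex.exp ∘ L =ᶠ[𝓝 w] Complex.Gamma :=
    Filter.eventuallyEq_of_mem (Complex.isOpen_slitPlane.mem_nhds hw) hL
  have hLw : Complex.exp (L w) = Complex.Gamma w := hL hw
  have h := HasFDerivAt.of_comp_of_leftInverse
    (f'symm := ContinuousLinearMap.toSpanSingleton ℂ (Complex.Gamma w)⁻¹)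
    (hLc.continuousAt (Complex.isOpen_slitPlane.mem_nhds hw))
    (Complex.hasDerivAt_exp (L w)).hasFDerivAt (hasDerivAt_gamma hw).hasFDerivAt hev
    (by intro u; simp [hLw, hne])
  refine h.hasDerivAt.congr_deriv ?_
  simp
  field_simp

/-- `logGamma` is a logarithm of `Γ` on the cut plane. -/
lemma exp_logGamma {w : ℂ} (hw : w ∈ Complex.slitPlane) :
    Complex.exp (logGamma w) = Complex.Gamma w := by
  obtain ⟨L, hL, hL'⟩ := exists_log_gamma
  rw [logGamma_eq_sub hw fun t h0 h1 => hL' _ (segment_mem_slitPlane hw h0 h1),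
    Complex.exp_sub, hL w hw, hL 1 Complex.one_mem_slitPlane, Complex.Gamma_one, div_one]

/-- `logGamma` is holomorphic on the cut plane, with derivative `Γ' / Γ`. -/
lemma hasDerivAt_logGamma {w : ℂ} (hw : w ∈ Complex.slitPlane) :
    HasDerivAt logGamma (Complex.digamma w) w := by
  obtain ⟨L, -, hL'⟩ := exists_log_gamma
  refine ((hL' w hw).sub_const (L 1)).congr_of_eventuallyEq ?_
  filter_upwards [Complex.isOpen_slitPlane.mem_nhds hw] with u hu
  exact logGamma_eq_sub hu fun t h0 h1 => hL' _ (segment_mem_slitPlane hu h0 h1)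

/-- `logGamma` is the real logarithm of `Γ` on the positive axis. -/
lemma logGamma_ofReal {x : ℝ} (hx : 0 < x) :
    logGamma (x : ℂ) = (Real.log (Real.Gamma x) : ℂ) := by
  have hxs : (x : ℂ) ∈ Complex.slitPlane := Or.inl (by simpa using hx)
  rw [logGamma_eq_sub (L := fun w => Complex.log (Complex.Gamma w)) hxs]
  · simp [Complex.Gamma_ofReal, Complex.ofReal_log (Real.Gamma_pos_of_pos hx).le]
  · intro t h0 h1
    have hs := segment_mem_slitPlane hxs h0 h1
    have hpos : 0 < 1 + t * (x - 1) := by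
      rcases h1.eq_or_lt with rfl | h1
      · linarith
      · nlinarith [mul_nonneg h0 hx.le]
    have he : 1 + (t : ℂ) * ((x : ℂ) - 1) = ((1 + t * (x - 1) : ℝ) : ℂ) := by push_cast; ring
    have hG : Complex.Gamma (1 + (t : ℂ) * ((x : ℂ) - 1)) ∈ Complex.slitPlane := by
      rw [he, Complex.Gamma_ofReal]
      exact Or.inl (by simpa using Real.Gamma_pos_of_pos hpos)
    have h := (hasDerivAt_gamma hs).clog hG
    rwa [mul_div_cancel_left₀ _ (Complex.Gamma_ne_zero (gamma_ne_zero_of_mem_slitPlane hs))] at h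

/-- `gammaPow γ` is holomorphic on the cut plane. -/
lemma differentiableOn_gammaPow (γ : ℝ) :
    DifferentiableOn ℂ (gammaPow γ) Complex.slitPlane := fun _ hw =>
  ((hasDerivAt_logGamma hw).differentiableAt.const_mul
    (γ : ℂ)).cexp.differentiableWithinAt

/-- `gammaPow γ` is the positive real power `[Γ(x)] ^ γ` on the positive axis. -/
lemma gammaPow_ofReal (γ : ℝ) {x : ℝ} (hx : 0 < x) :
    gammaPow γ (x : ℂ) = ((Real.Gamma x ^ γ : ℝ) : ℂ) := by
  rw [gammaPow, logGamma_ofReal hx, Real.rpow_def_of_pos (Real.Gamma_pos_of_pos hx)]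
  push_cast
  rw [mul_comm]

/-- The integrand `Γ(s) Γ(1 - s) (-z) ^ (-s) / [Γ(-α s + β)] ^ γ`, where
`(-z) ^ (-s) = exp (-s (log |z| + i θ))` and `θ` is the chosen value of `Arg (-z)`. -/
def integrand (α β γ : ℝ) (z : ℂ) (θ : ℝ) (s : ℂ) : ℂ :=
  Complex.Gamma s * Complex.Gamma (1 - s) / gammaPow γ (-(α : ℂ) * s + (β : ℂ)) *
    Complex.exp (-s * ((Real.log ‖z‖ : ℂ) + Complex.I * (θ : ℂ)))

/-- `ζ` parametrizes (over `ℝ`) a left loop: a curve starting at `-∞ + i φ₁`, terminating at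
`-∞ + i φ₂`, and crossing the real line at the point `c` only. The finite limits of the imaginary
part, with continuity, keep it in a horizontal strip. The regularity asked for (continuity,
differentiability off a countable set, locally integrable derivative) covers every
piecewise `C¹` curve. -/
structure IsLeftLoop (c φ₁ φ₂ : ℝ) (ζ : ℝ → ℂ) : Prop where
  continuous : Continuous ζ
  differentiable : ∃ S : Set ℝ, S.Countable ∧ ∀ t ∉ S, DifferentiableAt ℝ ζ t
  integrable : ∀ a b : ℝ, IntervalIntegrable (deriv ζ) volume a b
  re_start : Tendsto (fun t => (ζ t).re) atBot atBot
  im_start : Tendsto (fun t => (ζ t).im) atBot (𝓝 φ₁)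
  re_end : Tendsto (fun t => (ζ t).re) atTop atBot
  im_end : Tendsto (fun t => (ζ t).im) atTop (𝓝 φ₂)
  crosses : ∃ t, ζ t = (c : ℂ)
  crosses_only : ∀ t, (ζ t).im = 0 → ζ t = (c : ℂ)

/-- The integral `∫ f(s) ds` along the infinite curve `ζ` converges to `J`, as the limit of the
integrals along the bounded arcs of the curve when both ends of the arc tend to infinity. -/
def HasCurveIntegral (f : ℂ → ℂ) (ζ : ℝ → ℂ) (J : ℂ) : Prop :=
  (∀ a b : ℝ, IntervalIntegrable (fun t => f (ζ t) * deriv ζ t) volume a b) ∧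
    Tendsto (fun p : ℝ × ℝ => ∫ t in p.1..p.2, f (ζ t) * deriv ζ t) (atBot ×ˢ atTop) (𝓝 J)

/-- `f` has an isolated singularity at `a` (or is holomorphic there), with residue `r`. -/
def HasResidueAt (f : ℂ → ℂ) (a r : ℂ) : Prop :=
  (∀ᶠ s in 𝓝[≠] a, DifferentiableAt ℂ f s) ∧
    ∀ᶠ ρ in 𝓝[>] (0 : ℝ), 1 / (2 * Real.pi * Complex.I) * (∮ s in C(a, ρ), f s) = r

end LeRoy

end

/-!
The poles of the integrand `f` to the left of the loop are `-1, -2, …`; by the reflection formula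
`f(s) = π h(s) / sin (π s)` with `h` (`holoFactor`) holomorphic off `[β / α, ∞)`, and the residue
at `-(k + 1)` is `z ^ (k + 1) / [Γ(α (k + 1) + β)] ^ γ`, the term of index `k + 1` of the series
(`holoFactor_neg_nat`, `hasResidueAt_integrand`). The sum of the residues is therefore
`F(z) - 1 / [Γ(β)] ^ γ`, and the point is to show that it is the integral along the loop.

The loop may intersect itself, so no contour is closed up. Instead, the plane cut along `(-∞, -1]`
and `[0, ∞)` contains the loop, and `f` has a primitive `P` there (`exists_primitive_slitDomain`).
The integral along an arc is the difference of the values of `P` at its ends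
(`IsLeftLoop.integral_eq_sub`), so only the limits of `P` at `-∞ + iφ₁` and `-∞ + iφ₂` matter.
They exist because `f(s) = O(e ^ re s)` at the left end of a horizontal strip, away from the poles:
the functional equation makes `|Γ|` grow faster to the right than any exponential
(`exists_exp_le_norm_Gamma`, `exists_norm_holoFactor_le`, `exists_tendsto_of_norm_deriv_le_exp`).

The difference of the limits is found along the abscissas `-N - 1/2`. There
`P(-N - 1/2 + iφ₂) - P(-N - 1/2 + iφ₁)` minus the integral of `f` over the vertical segment is
`2πi` times the sum of the first `N` residues (`residue_jump`, `sum_term_eq`), and the vertical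
integrals tend to `0` (`tendsto_verticalIntegral`).
-/

noncomputable section

namespace LeRoy

/-! ### Primitives of holomorphic functions -/

lemma sub_eq_sub_of_hasDerivAt {S : Set ℂ} (hS : Convex ℝ S) {f F G : ℂ → ℂ}
    (hF : ∀ s ∈ S, HasDerivAt F (f s) s) (hG : ∀ s ∈ S, HasDerivAt G (f s) s)
    {a b : ℂ} (ha : a ∈ S) (hb : b ∈ S) : F b - F a = G b - G a := by
  have h := hS.norm_image_sub_le_of_norm_hasDerivWithin_le (f := fun s => F s - G s)
    (f' := fun _ => 0) (C := 0)
    (fun s hs => (((hF s hs).fun_sub (hG s hs)).congr_deriv (sub_self _)).hasDerivWithinAt)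
    (fun s _ => by simp) ha hb
  simp only [zero_mul, norm_le_zero_iff] at h
  linear_combination h

lemma exists_primitive_of_convex {S : Set ℂ} (hS : Convex ℝ S) (hS' : IsOpen S) {f : ℂ → ℂ}
    (hf : DifferentiableOn ℂ f S) : ∃ F : ℂ → ℂ, ∀ s ∈ S, HasDerivAt F (f s) s := by
  obtain ⟨F, hF⟩ := hS.exists_forall_hasDerivWithinAt hf
  exact ⟨F, fun s hs => (hF s hs).hasDerivAt (hS'.mem_nhds hs)⟩

lemma convex_strip (a b : ℝ) : Convex ℝ {s : ℂ | a < s.re ∧ s.re < b} :=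
  (convex_halfSpace_re_gt a).inter (convex_halfSpace_re_lt b)

lemma isOpen_strip (a b : ℝ) : IsOpen {s : ℂ | a < s.re ∧ s.re < b} :=
  (isOpen_lt continuous_const Complex.continuous_re).inter
    (isOpen_lt Complex.continuous_re continuous_const)

lemma isOpen_upper : IsOpen {s : ℂ | 0 < s.im} := isOpen_lt continuous_const Complex.continuous_im

lemma isOpen_lower : IsOpen {s : ℂ | s.im < 0} := isOpen_lt Complex.continuous_im continuous_const

/-- The plane cut along `(-∞, -1]` and `[0, ∞)`, a domain avoiding all integers that contains
every left loop crossing the real line between `-1` and `0`. -/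
def slitDomain : Set ℂ := {s | s.im ≠ 0 ∨ (-1 < s.re ∧ s.re < 0)}

/-- Primitives on the two half planes are glued along a primitive on the strip
`-1 < re s < 0`, which meets each of the half planes in a convex set. -/
lemma exists_primitive_slitDomain {f : ℂ → ℂ} (hf : DifferentiableOn ℂ f slitDomain) :
    ∃ P : ℂ → ℂ, ∀ s ∈ slitDomain, HasDerivAt P (f s) s := by
  obtain ⟨M, hM⟩ := exists_primitive_of_convex (convex_strip (-1) 0) (isOpen_strip (-1) 0)
    (hf.mono fun s hs => Or.inr hs)
  obtain ⟨A, hA⟩ := exists_primitive_of_convex (convex_halfSpace_im_gt 0) isOpen_upper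
    (hf.mono fun s (hs : 0 < s.im) => Or.inl hs.ne')
  obtain ⟨B, hB⟩ := exists_primitive_of_convex (convex_halfSpace_im_lt 0) isOpen_lower
    (hf.mono fun s (hs : s.im < 0) => Or.inl hs.ne)
  -- Points of the strip in the upper and the lower half plane, where the constants are matched.
  let p : ℂ := ⟨-1 / 2, 1⟩
  let q : ℂ := ⟨-1 / 2, -1⟩
  let P : ℂ → ℂ := fun s => if 0 < s.im then A s - A p + M p else
    if s.im < 0 then B s - B q + M q else M s
  have hPM : ∀ s : ℂ, -1 < s.re ∧ s.re < 0 → P s = M s := by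
    intro s hs
    simp only [P]
    split_ifs with h1 h2
    · have := sub_eq_sub_of_hasDerivAt
        ((convex_strip (-1) 0).inter (convex_halfSpace_im_gt 0)) (F := A) (G := M) (f := f)
        (a := p) (b := s) (fun s hs => hA s hs.2) (fun s hs => hM s hs.1)
        ⟨by constructor <;> norm_num [p], by norm_num [p]⟩ ⟨hs, h1⟩
      linear_combination this
    · have := sub_eq_sub_of_hasDerivAt
        ((convex_strip (-1) 0).inter (convex_halfSpace_im_lt 0)) (F := B) (G := M) (f := f)
        (a := q) (b := s) (fun s hs => hB s hs.2) (fun s hs => hM s hs.1)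
        ⟨by constructor <;> norm_num [q], by norm_num [q]⟩ ⟨hs, h2⟩
      linear_combination this
    · rfl
  refine ⟨P, fun s hs => ?_⟩
  rcases lt_trichotomy s.im 0 with h | h | h
  · refine (((hB s h).sub_const (B q)).add_const (M q)).congr_of_eventuallyEq ?_
    filter_upwards [isOpen_lower.mem_nhds h] with u hu
    have hu : u.im < 0 := hu
    simp [P, hu, hu.le]
  · have hs' : -1 < s.re ∧ s.re < 0 := hs.resolve_left (not_not.mpr h)
    refine (hM s hs').congr_of_eventuallyEq ?_
    filter_upwards [(isOpen_strip (-1) 0).mem_nhds hs'] with u hu using hPM u hu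
  · refine (((hA s h).sub_const (A p)).add_const (M p)).congr_of_eventuallyEq ?_
    filter_upwards [isOpen_upper.mem_nhds h] with u hu
    have hu : 0 < u.im := hu
    simp [P, hu]

/-! ### Vertical integrals and the residue jump -/

/-- The integral of `f` along the segment from `x + i φ₁` to `x + i φ₂`. -/
def verticalIntegral (f : ℂ → ℂ) (φ₁ φ₂ x : ℝ) : ℂ :=
  ∫ y in φ₁..φ₂, f (x + y * Complex.I) * Complex.I

lemma verticalIntegral_eq_sub {f F : ℂ → ℂ} {a b x : ℝ} (φ₁ φ₂ : ℝ) (hx : a < x ∧ x < b)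
    (hf : ContinuousOn f {s : ℂ | a < s.re ∧ s.re < b})
    (hF : ∀ s : ℂ, a < s.re ∧ s.re < b → HasDerivAt F (f s) s) :
    verticalIntegral f φ₁ φ₂ x = F (x + φ₂ * Complex.I) - F (x + φ₁ * Complex.I) := by
  have hmem : ∀ y : ℝ, a < ((x : ℂ) + y * Complex.I).re ∧ ((x : ℂ) + y * Complex.I).re < b := by
    intro y; simpa using hx
  refine intervalIntegral.integral_eq_sub_of_hasDerivAt (f := fun y : ℝ => F (x + y * Complex.I))
    (fun y _ => ?_) ?_
  · have h1 : HasDerivAt (fun y : ℝ => (x : ℂ) + y * Complex.I) Complex.I y := by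
      simpa using ((Complex.ofRealCLM.hasDerivAt (x := y)).mul_const Complex.I).const_add (x : ℂ)
    exact (hF _ (hmem y)).comp y h1
  · apply Continuous.intervalIntegrable
    have : Continuous fun y : ℝ => f (x + y * Complex.I) :=
      hf.comp_continuous (by fun_prop) hmem
    exact this.mul continuous_const

lemma hasDerivAt_log_sub {a s : ℂ} (h : s - a ∈ Complex.slitPlane) :
    HasDerivAt (fun s => Complex.log (s - a)) (s - a)⁻¹ s := by
  simpa using ((hasDerivAt_id s).sub_const a).clog h

lemma hasDerivAt_log_sub' {a s : ℂ} (h : a - s ∈ Complex.slitPlane) :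
    HasDerivAt (fun s => Complex.log (a - s)) (s - a)⁻¹ s := by
  have h1 := ((hasDerivAt_id s).const_sub a).clog h
  refine h1.congr_deriv ?_
  rw [id, ← neg_sub s a, neg_div_neg_eq, one_div]

/-- Across a simple pole `a` with residue `q a`, the difference between the primitive taken at
heights `φ₂ > 0` and `φ₁ < 0` and the vertical integral jumps by `2πi q(a)`. Away from the pole
`f` is holomorphic plus `q(a) / (s - a)`; the right side of the strip uses the logarithm of
`s - a`, the left side the logarithm of `a - s`, and these two differ by `± iπ` above and below
the real axis. -/
lemma residue_jump {f q P : ℂ → ℂ} {a x₀ x₁ φ₁ φ₂ : ℝ} (hφ₁ : φ₁ < 0) (hφ₂ : 0 < φ₂)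
    (hx₀ : a < x₀ ∧ x₀ < a + 1) (hx₁ : a - 1 < x₁ ∧ x₁ < a)
    (hq : DifferentiableOn ℂ q {s : ℂ | a - 1 < s.re ∧ s.re < a + 1})
    (hfq : ∀ s : ℂ, a - 1 < s.re ∧ s.re < a + 1 → s ≠ a → f s = q s / (s - a))
    (hP : ∀ s : ℂ, s.im ≠ 0 → HasDerivAt P (f s) s) :
    (P (x₁ + φ₂ * Complex.I) - P (x₁ + φ₁ * Complex.I) - verticalIntegral f φ₁ φ₂ x₁) -
      (P (x₀ + φ₂ * Complex.I) - P (x₀ + φ₁ * Complex.I) - verticalIntegral f φ₁ φ₂ x₀) =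
    2 * Real.pi * Complex.I * q a := by
  set T : Set ℂ := {s : ℂ | a - 1 < s.re ∧ s.re < a + 1} with hT
  have hTo : IsOpen T := isOpen_strip _ _
  have haT : (a : ℂ) ∈ T := by simp [hT]
  have hg : DifferentiableOn ℂ (dslope q a) T :=
    (Complex.differentiableOn_dslope (hTo.mem_nhds haT)).2 hq
  obtain ⟨G, hG⟩ := exists_primitive_of_convex (convex_strip _ _) hTo hg
  have hfg : ∀ s ∈ T, s ≠ a → f s = dslope q a s + q a * (s - a)⁻¹ := by
    intro s hs hne
    have h0 : s - a ≠ 0 := sub_ne_zero.2 hne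
    rw [hfq s hs hne, dslope_of_ne _ hne, slope_def_field]
    field_simp
    ring
  have hR : ∀ s ∈ T, s - a ∈ Complex.slitPlane →
      HasDerivAt (fun s => G s + q a * Complex.log (s - a)) (f s) s := by
    intro s hs h
    have hne : s ≠ a := by rintro rfl; simp at h
    rw [hfg s hs hne]
    exact (hG s hs).add ((hasDerivAt_log_sub h).const_mul _)
  have hL : ∀ s ∈ T, a - s ∈ Complex.slitPlane →
      HasDerivAt (fun s => G s + q a * Complex.log (a - s)) (f s) s := by
    intro s hs h
    have hne : s ≠ a := by rintro rfl; simp at h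
    rw [hfg s hs hne]
    exact (hG s hs).add ((hasDerivAt_log_sub' h).const_mul _)
  have hfT : ContinuousOn f (T \ {(a : ℂ)}) := by
    have : ContinuousOn (fun s => q s / (s - a)) (T \ {(a : ℂ)}) :=
      (hq.continuousOn.mono Set.sdiff_subset).div (by fun_prop)
        fun s hs => sub_ne_zero.2 hs.2
    exact this.congr fun s hs => hfq s hs.1 hs.2
  have hV0 := verticalIntegral_eq_sub φ₁ φ₂ hx₀ (f := f)
    (hfT.mono fun s hs => ⟨⟨by linarith [hs.1], hs.2⟩, by rintro rfl; simp at hs⟩)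
    (fun s hs => hR s ⟨by linarith [hs.1], hs.2⟩ (Or.inl (by simpa using hs.1)))
  have hV1 := verticalIntegral_eq_sub φ₁ φ₂ hx₁ (f := f)
    (hfT.mono fun s hs => ⟨⟨hs.1, by linarith [hs.2]⟩, by rintro rfl; simp at hs⟩)
    (fun s hs => hL s ⟨hs.1, by linarith [hs.2]⟩ (Or.inl (by simpa using hs.2)))
  have hmem : ∀ {x y : ℝ}, a - 1 < x ∧ x < a + 1 → (x : ℂ) + y * Complex.I ∈ T := by
    intro x y hx; simpa [hT] using hx
  -- `log (s - a)` is holomorphic off the real axis, so it serves on both sides of the pole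
  -- inside each half plane.
  have hup := sub_eq_sub_of_hasDerivAt (F := P)
    ((convex_strip (a - 1) (a + 1)).inter (convex_halfSpace_im_gt 0))
    (fun s hs => hP s (ne_of_gt hs.2))
    (fun s hs => hR s hs.1 (Or.inr (by simpa using (ne_of_gt hs.2))))
    (a := x₀ + φ₂ * Complex.I) (b := x₁ + φ₂ * Complex.I)
    ⟨hmem ⟨by linarith, hx₀.2⟩, by simpa using hφ₂⟩ ⟨hmem ⟨hx₁.1, by linarith⟩, by simpa using hφ₂⟩
  have hlow := sub_eq_sub_of_hasDerivAt (F := P)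
    ((convex_strip (a - 1) (a + 1)).inter (convex_halfSpace_im_lt 0))
    (fun s hs => hP s (ne_of_lt hs.2))
    (fun s hs => hR s hs.1 (Or.inr (by simpa using (ne_of_lt hs.2))))
    (a := x₀ + φ₁ * Complex.I) (b := x₁ + φ₁ * Complex.I)
    ⟨hmem ⟨by linarith, hx₀.2⟩, by simpa using hφ₁⟩ ⟨hmem ⟨hx₁.1, by linarith⟩, by simpa using hφ₁⟩
  -- The two logarithms differ by `iπ` above and by `-iπ` below the real axis.
  have hlogup : Complex.log (a - (x₁ + φ₂ * Complex.I)) =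
      Complex.log (x₁ + φ₂ * Complex.I - a) - Real.pi * Complex.I := by
    rw [← neg_sub, Complex.log, Complex.log, norm_neg,
      Complex.arg_neg_eq_arg_sub_pi_of_im_pos (by simpa using hφ₂)]
    push_cast; ring
  have hloglow : Complex.log (a - (x₁ + φ₁ * Complex.I)) =
      Complex.log (x₁ + φ₁ * Complex.I - a) + Real.pi * Complex.I := by
    rw [← neg_sub, Complex.log, Complex.log, norm_neg,
      Complex.arg_neg_eq_arg_add_pi_of_im_neg (by simpa using hφ₁)]
    push_cast; ring
  rw [hV0, hV1]
  simp only [hlogup, hloglow]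
  linear_combination hup - hlow

/-! ### Limits of a primitive at the left end of a strip -/

/-- If `P'` is `O(e ^ re s)` at the left end of a horizontal strip, then `P` has a limit there:
the values of `P` at equally spaced points form a Cauchy sequence, and by the mean value
inequality `P` stays close to them. -/
lemma exists_tendsto_of_norm_deriv_le_exp {P f : ℂ → ℂ} {y₁ y₂ φ X C : ℝ} (h₁ : y₁ < φ)
    (h₂ : φ < y₂) (hP : ∀ s : ℂ, s.re ≤ -X → y₁ < s.im ∧ s.im < y₂ → HasDerivAt P (f s) s)
    (hf : ∀ s : ℂ, s.re ≤ -X → y₁ < s.im ∧ s.im < y₂ → ‖f s‖ ≤ C * Real.exp s.re) :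
    ∃ l : ℂ, Tendsto P (comap Complex.re atBot ⊓ comap Complex.im (𝓝 φ)) (𝓝 l) := by
  set D : ℝ := |C| * Real.exp (-X) * (1 + (y₂ - y₁)) with hD
  let p : ℕ → ℂ := fun n => ⟨-X - n, φ⟩
  have key : ∀ (n : ℕ) (s : ℂ), -X - n - 1 ≤ s.re → s.re ≤ -X - n → y₁ < s.im → s.im < y₂ →
      dist (P (p n)) (P s) ≤ D * Real.exp (-1) ^ n := by
    intro n s hs1 hs2 hs3 hs4
    have hn : (0 : ℝ) ≤ n := n.cast_nonneg
    have hconv : Convex ℝ {s : ℂ | s.re ≤ -X - n ∧ y₁ < s.im ∧ s.im < y₂} :=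
      (convex_halfSpace_re_le _).inter ((convex_halfSpace_im_gt _).inter (convex_halfSpace_im_lt _))
    have h := hconv.norm_image_sub_le_of_norm_hasDerivWithin_le (f := P) (f' := f)
      (C := |C| * Real.exp (-X - n))
      (fun u hu => (hP u (by linarith [hu.1]) hu.2).hasDerivWithinAt)
      (fun u hu => (hf u (by linarith [hu.1]) hu.2).trans
        (mul_le_mul (le_abs_self C) (Real.exp_le_exp.2 hu.1) (Real.exp_pos _).le (abs_nonneg C)))
      (x := s) (y := p n) ⟨hs2, hs3, hs4⟩ ⟨by simp [p], h₁, h₂⟩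
    have hd : ‖p n - s‖ ≤ 1 + (y₂ - y₁) := by
      refine (Complex.norm_le_abs_re_add_abs_im _).trans (add_le_add ?_ ?_)
      · simp only [Complex.sub_re, p]; rw [abs_le]; constructor <;> linarith
      · simp only [Complex.sub_im, p]; rw [abs_le]; constructor <;> linarith
    rw [dist_eq_norm]
    refine h.trans ?_
    have he : Real.exp (-X - n) = Real.exp (-X) * Real.exp (-1) ^ n := by
      rw [← Real.exp_nat_mul, ← Real.exp_add]; ring_nf
    calc |C| * Real.exp (-X - n) * ‖p n - s‖ ≤ |C| * Real.exp (-X - n) * (1 + (y₂ - y₁)) := by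
          gcongr
      _ = D * Real.exp (-1) ^ n := by rw [he, hD]; ring
  have hr1 : Real.exp (-1) < 1 := by simp
  have hstep : ∀ n, dist (P (p n)) (P (p (n + 1))) ≤ D * Real.exp (-1) ^ n := fun n =>
    key n _ (by simp only [p]; push_cast; linarith)
      (by simp only [p]; push_cast; linarith) h₁ h₂
  obtain ⟨l, hl⟩ := cauchySeq_tendsto_of_complete (cauchySeq_of_le_geometric _ _ hr1 hstep)
  refine ⟨l, ?_⟩
  have hre : Tendsto (fun s : ℂ => -X - s.re)
      (comap Complex.re atBot ⊓ comap Complex.im (𝓝 φ)) atTop := by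
    have h0 : Tendsto Complex.re (comap Complex.re atBot ⊓ comap Complex.im (𝓝 φ)) atBot :=
      tendsto_comap.mono_left inf_le_left
    simpa [sub_eq_add_neg] using
      tendsto_atTop_add_const_left _ (-X) (tendsto_neg_atBot_atTop.comp h0)
  have hn := tendsto_nat_floor_atTop.comp hre
  have him : ∀ᶠ s in comap Complex.re atBot ⊓ comap Complex.im (𝓝 φ), y₁ < s.im ∧ s.im < y₂ :=
    (tendsto_comap.mono_left inf_le_right :
      Tendsto Complex.im (comap Complex.re atBot ⊓ comap Complex.im (𝓝 φ)) (𝓝 φ)).eventually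
      (Ioo_mem_nhds h₁ h₂)
  refine (hl.comp hn).congr_dist ?_
  refine squeeze_zero' (Eventually.of_forall fun _ => dist_nonneg) ?_
    (by simpa using ((tendsto_pow_atTop_nhds_zero_of_lt_one (Real.exp_pos _).le hr1).comp
      hn).const_mul D)
  filter_upwards [him, hre.eventually_ge_atTop 0] with s hs hs0
  have hs0 : 0 ≤ -X - s.re := hs0
  have ha := Nat.floor_le hs0
  have hb := Nat.lt_floor_add_one (-X - s.re)
  exact key _ s (by simp only [Function.comp]; linarith) (by simp only [Function.comp]; linarith)
    hs.1 hs.2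

/-! ### Growth of the Gamma function in horizontal strips -/

/-- In a horizontal strip `|Γ|` eventually dominates every exponential `e ^ (A re w)`: once
`re w ≥ e ^ A`, the functional equation shows that `|Γ(w)| e ^ (-A re w)` does not decrease under
`w ↦ w + 1`, and on a rectangle of width `1` it is bounded below. -/
lemma exists_exp_le_norm_Gamma (A H : ℝ) : ∃ m > 0, ∃ X : ℝ, ∀ w : ℂ, X ≤ w.re → |w.im| ≤ H →
    m * Real.exp (A * w.re) ≤ ‖Complex.Gamma w‖ := by
  set X := Real.exp A with hX
  have hX0 : 0 < X := Real.exp_pos A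
  have hne : ∀ w : ℂ, 0 < w.re → ∀ n : ℕ, w ≠ -n := fun w hw =>
    gamma_ne_zero_of_mem_slitPlane (Or.inl hw)
  have hK : IsCompact (Set.Icc X (X + 1) ×ℂ Set.Icc (-H) H) := isCompact_Icc.reProdIm isCompact_Icc
  have hcont : ContinuousOn (fun w : ℂ => ‖Complex.Gamma w‖ * Real.exp (-(A * w.re)))
      (Set.Icc X (X + 1) ×ℂ Set.Icc (-H) H) := by
    refine ContinuousOn.mul (fun w hw => ?_) (by fun_prop)
    exact (Complex.differentiableAt_Gamma w
      (hne w (hX0.trans_le hw.1.1))).continuousAt.norm.continuousWithinAt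
  obtain ⟨m, hm, hmin⟩ := hK.exists_forall_le' hcont (a := 0) fun w hw =>
    mul_pos (norm_pos_iff.2 (Complex.Gamma_ne_zero (hne w (hX0.trans_le hw.1.1)))) (Real.exp_pos _)
  have hind : ∀ n : ℕ, ∀ w : ℂ, X + n ≤ w.re → w.re ≤ X + n + 1 → |w.im| ≤ H →
      m * Real.exp (A * w.re) ≤ ‖Complex.Gamma w‖ := by
    intro n
    induction n with
    | zero =>
      intro w h1 h2 h3
      have h := hmin w ⟨⟨by simpa using h1, by simpa using h2⟩, abs_le.1 h3⟩
      rwa [Real.exp_neg, ← div_eq_mul_inv, le_div_iff₀ (Real.exp_pos _)] at h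
    | succ n ih =>
      intro w h1 h2 h3
      push_cast at h1 h2
      have hn : (0 : ℝ) ≤ n := n.cast_nonneg
      have hre : X ≤ (w - 1).re := by simp; linarith
      have h := ih (w - 1) (by simp; linarith) (by simp; linarith) (by simpa using h3)
      have hne' : w - 1 ≠ 0 := by
        intro h0; rw [h0] at hre; simp at hre; linarith
      have hG : Complex.Gamma w = (w - 1) * Complex.Gamma (w - 1) := by
        have := Complex.Gamma_add_one (w - 1) hne'
        rwa [sub_add_cancel] at this
      have hexp : Real.exp (A * w.re) = X * Real.exp (A * (w - 1).re) := by
        rw [hX, ← Real.exp_add]; congr 1; simp; ring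
      rw [hG, norm_mul, hexp]
      calc m * (X * Real.exp (A * (w - 1).re)) = X * (m * Real.exp (A * (w - 1).re)) := by ring
        _ ≤ ‖w - 1‖ * ‖Complex.Gamma (w - 1)‖ :=
          mul_le_mul (hre.trans (Complex.re_le_norm _)) h (by positivity) (norm_nonneg _)
  refine ⟨m, hm, X, fun w h1 h2 => ?_⟩
  have ha := Nat.floor_le (sub_nonneg.2 h1)
  have hb := Nat.lt_floor_add_one (w.re - X)
  exact hind ⌊w.re - X⌋₊ w (by linarith) (by linarith) h2

lemma norm_gammaPow (γ : ℝ) {w : ℂ} (hw : w ∈ Complex.slitPlane) :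
    ‖gammaPow γ w‖ = ‖Complex.Gamma w‖ ^ γ := by
  rw [gammaPow, ← exp_logGamma hw, Complex.norm_exp, Complex.norm_exp, ← Real.exp_mul,
    Complex.re_ofReal_mul, mul_comm]

/-! ### The holomorphic factor of the integrand -/

/-- The integrand without its factor `Γ(s) Γ(1 - s) = π / sin (π s)`; it is holomorphic off the
cut `[β / α, ∞)`. -/
def holoFactor (α β γ : ℝ) (z : ℂ) (θ : ℝ) (s : ℂ) : ℂ :=
  Complex.exp (-s * ((Real.log ‖z‖ : ℂ) + Complex.I * (θ : ℂ))) /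
    gammaPow γ (-(α : ℂ) * s + (β : ℂ))

lemma integrand_eq (α β γ : ℝ) (z : ℂ) (θ : ℝ) (s : ℂ) :
    integrand α β γ z θ s =
      Real.pi * holoFactor α β γ z θ s / Complex.sin (Real.pi * s) := by
  rw [integrand, holoFactor, Complex.Gamma_mul_Gamma_one_sub]
  ring

lemma mem_slitPlane_of_cut {α β : ℝ} (hα : 0 < α) (hβ : 0 < β) {s : ℂ}
    (hs : s.im ≠ 0 ∨ s.re < 0) : -(α : ℂ) * s + (β : ℂ) ∈ Complex.slitPlane := by
  rcases hs with h | h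
  · exact Or.inr (by simpa [hα.ne'] using h)
  · refine Or.inl ?_
    have := mul_neg_of_pos_of_neg hα h
    simp; linarith

lemma differentiableAt_holoFactor {α β : ℝ} (hα : 0 < α) (hβ : 0 < β) (γ : ℝ) (z : ℂ) (θ : ℝ)
    {s : ℂ} (hs : s.im ≠ 0 ∨ s.re < 0) : DifferentiableAt ℂ (holoFactor α β γ z θ) s := by
  have h1 : DifferentiableAt ℂ (gammaPow γ) (-(α : ℂ) * s + (β : ℂ)) :=
    (differentiableOn_gammaPow γ).differentiableAt
      (Complex.isOpen_slitPlane.mem_nhds (mem_slitPlane_of_cut hα hβ hs))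
  have h2 : DifferentiableAt ℂ (fun s : ℂ => gammaPow γ (-(α : ℂ) * s + (β : ℂ))) s :=
    DifferentiableAt.comp (g := gammaPow γ) s h1 (by fun_prop)
  exact DifferentiableAt.div (by fun_prop) h2 (Complex.exp_ne_zero _)

/-- With `Γ` growing faster than `e ^ (A re w)` for the rate `A = (1 + log |z|) / (α γ)`, the power
of `z` is absorbed and a factor `e ^ re s` is left over. -/
lemma exists_norm_holoFactor_le {α γ : ℝ} (hα : 0 < α) (hγ : 0 < γ) {β : ℝ} (hβ : 0 < β) (z : ℂ)
    (θ H : ℝ) : ∃ C X : ℝ, ∀ s : ℂ, s.re ≤ -X → |s.im| ≤ H →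
      ‖holoFactor α β γ z θ s‖ ≤ C * Real.exp s.re := by
  set L := Real.log ‖z‖ with hL
  set A := (1 + L) / (α * γ) with hA
  obtain ⟨m, hm, Y, hY⟩ := exists_exp_le_norm_Gamma A (α * H)
  refine ⟨Real.exp (H * |θ|) / (m ^ γ * Real.exp (A * β * γ)), max 1 (Y / α),
    fun s hs him => ?_⟩
  have hs0 : s.re < 0 := by linarith [le_max_left 1 (Y / α)]
  have hsY : Y ≤ α * -s.re := by
    rw [← div_le_iff₀' hα]; linarith [le_max_right 1 (Y / α)]
  have hre : (-(α : ℂ) * s + (β : ℂ)).re = -α * s.re + β := by simp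
  have him' : (-(α : ℂ) * s + (β : ℂ)).im = -α * s.im := by simp
  have hG := hY (-(α : ℂ) * s + (β : ℂ)) (by rw [hre]; linarith)
    (by rw [him', abs_mul, abs_neg, abs_of_pos hα]; gcongr)
  rw [hre] at hG
  have hpow : m ^ γ * Real.exp (A * β * γ) * Real.exp (-(1 + L) * s.re) ≤
      ‖gammaPow γ (-(α : ℂ) * s + (β : ℂ))‖ := by
    rw [norm_gammaPow γ (mem_slitPlane_of_cut hα hβ (Or.inr hs0))]
    refine le_trans (le_of_eq ?_) (Real.rpow_le_rpow (by positivity) hG hγ.le)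
    rw [Real.mul_rpow hm.le (Real.exp_pos _).le, ← Real.exp_mul, mul_assoc, ← Real.exp_add]
    congr 2
    rw [hA]; field_simp; ring
  have hnum : ‖Complex.exp (-s * ((L : ℂ) + Complex.I * (θ : ℂ)))‖ ≤
      Real.exp (H * |θ|) * Real.exp (-L * s.re) := by
    rw [Complex.norm_exp, ← Real.exp_add, Real.exp_le_exp]
    have h1 : s.im * θ ≤ H * |θ| :=
      (le_abs_self _).trans (by rw [abs_mul]; gcongr)
    have h2 : (-s * ((L : ℂ) + Complex.I * (θ : ℂ))).re = s.im * θ + -L * s.re := by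
      simp; ring
    linarith
  rw [holoFactor, norm_div]
  calc _ ≤ Real.exp (H * |θ|) * Real.exp (-L * s.re) /
        (m ^ γ * Real.exp (A * β * γ) * Real.exp (-(1 + L) * s.re)) := by gcongr
    _ = Real.exp (H * |θ|) / (m ^ γ * Real.exp (A * β * γ)) * Real.exp s.re := by
      have : Real.exp (-L * s.re) = Real.exp (-(1 + L) * s.re) * Real.exp s.re := by
        rw [← Real.exp_add]; congr 1; ring
      rw [this]; field_simp

/-- The value of `holoFactor` at `-k` is, up to sign, the `k`-th term of the series. -/
lemma holoFactor_neg_nat {α β : ℝ} (hα : 0 < α) (hβ : 0 < β) (γ : ℝ) {z : ℂ} (hz : z ≠ 0) {θ : ℝ}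
    (hθ : -z = (‖z‖ : ℂ) * Complex.exp (Complex.I * (θ : ℂ))) (k : ℕ) :
    holoFactor α β γ z θ (-(k : ℂ)) = (-1) ^ k * term α β γ z k := by
  have hpos : 0 < α * k + β := by positivity
  have hexp : Complex.exp ((Real.log ‖z‖ : ℂ) + Complex.I * (θ : ℂ)) = -z := by
    rw [Complex.exp_add, ← Complex.ofReal_exp, Real.exp_log (norm_pos_iff.2 hz), ← hθ]
  have harg : -(α : ℂ) * -(k : ℂ) + (β : ℂ) = ((α * k + β : ℝ) : ℂ) := by push_cast; ring
  rw [holoFactor, term, harg, gammaPow_ofReal γ hpos, neg_neg, Complex.exp_nat_mul, hexp, neg_pow,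
    mul_div_assoc]

/-! ### Bounds for the sine -/

lemma norm_sin_pi_mul_sq (s : ℂ) : ‖Complex.sin (Real.pi * s)‖ ^ 2 =
    Real.sin (Real.pi * s.re) ^ 2 + Real.sinh (Real.pi * s.im) ^ 2 := by
  have h : (Real.pi : ℂ) * s = ((Real.pi * s.re : ℝ) : ℂ) +
      ((Real.pi * s.im : ℝ) : ℂ) * Complex.I := by
    apply Complex.ext <;> simp
  rw [h, Complex.sin_add_mul_I, ← Complex.ofReal_sin, ← Complex.ofReal_cos, ← Complex.ofReal_cosh,
    ← Complex.ofReal_sinh, Complex.sq_norm, Complex.normSq_apply]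
  simp only [Complex.add_re, Complex.add_im, Complex.mul_re, Complex.mul_im, Complex.ofReal_re,
    Complex.ofReal_im, Complex.I_re, Complex.I_im]
  have h1 := Real.cosh_sq (Real.pi * s.im)
  have h2 := Real.sin_sq_add_cos_sq (Real.pi * s.re)
  linear_combination Real.sin (Real.pi * s.re) ^ 2 * h1 + Real.sinh (Real.pi * s.im) ^ 2 * h2

lemma le_norm_sin_of_le_abs_im {δ : ℝ} {s : ℂ} (hs : δ ≤ |s.im|) :
    δ ≤ ‖Complex.sin (Real.pi * s)‖ := by
  have h1 : |s.im| ≤ |Real.sinh (Real.pi * s.im)| := by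
    rw [Real.abs_sinh, abs_mul, abs_of_pos Real.pi_pos]
    have h2 : |s.im| ≤ Real.pi * |s.im| :=
      le_mul_of_one_le_left (abs_nonneg _) (by linarith [Real.pi_gt_three])
    exact h2.trans (Real.self_le_sinh_iff.2 (by positivity))
  refine hs.trans (h1.trans (abs_le_of_sq_le_sq ?_ (norm_nonneg _)))
  rw [norm_sin_pi_mul_sq]
  exact le_add_of_nonneg_left (sq_nonneg _)

lemma one_le_norm_sin_half_integer (n : ℕ) {s : ℂ} (hs : s.re = -n - 1 / 2) :
    1 ≤ ‖Complex.sin (Real.pi * s)‖ := by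
  have h := norm_sin_pi_mul_sq s
  have h1 : Real.sin (Real.pi * s.re) ^ 2 = 1 := by
    have : Real.pi * s.re = -(Real.pi / 2 + n * Real.pi) := by rw [hs]; ring
    rw [this, Real.sin_neg, Real.sin_add_nat_mul_pi, Real.sin_pi_div_two, neg_sq, mul_one, ← pow_mul,
      mul_comm, pow_mul]
    norm_num
  nlinarith [sq_nonneg (Real.sinh (Real.pi * s.im)), norm_nonneg (Complex.sin (Real.pi * s))]

lemma sin_pi_mul_ne_zero {s : ℂ} (hs : ∀ n : ℤ, s ≠ n) : Complex.sin (Real.pi * s) ≠ 0 := by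
  rw [Ne, Complex.sin_eq_zero_iff]
  rintro ⟨k, hk⟩
  refine hs k (mul_left_cancel₀ (Complex.ofReal_ne_zero.2 Real.pi_ne_zero) ?_)
  rw [hk, mul_comm]

lemma ne_int_of_mem_strip {m : ℤ} {s : ℂ} (h : (m : ℝ) - 1 < s.re ∧ s.re < m + 1) (hm : s ≠ m)
    (n : ℤ) : s ≠ n := by
  rintro rfl
  simp only [Complex.intCast_re] at h
  have h1 : m - 1 < n := by exact_mod_cast h.1
  have h2 : n < m + 1 := by exact_mod_cast h.2
  exact hm (by rw [show n = m by omega])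

lemma ne_int_of_mem_slitDomain {s : ℂ} (hs : s ∈ slitDomain) (n : ℤ) : s ≠ n := by
  rintro rfl
  rcases hs with h | ⟨h1, h2⟩
  · simp at h
  · simp only [Complex.intCast_re] at h1 h2
    have h1 : -1 < n := by exact_mod_cast h1
    have h2 : n < 0 := by exact_mod_cast h2
    omega

/-! ### The integrand near its poles -/

lemma differentiableOn_integrand {α β : ℝ} (hα : 0 < α) (hβ : 0 < β) (γ : ℝ) (z : ℂ) (θ : ℝ) :
    DifferentiableOn ℂ (integrand α β γ z θ) slitDomain := by
  intro s hs
  have h := differentiableAt_holoFactor hα hβ γ z θ (s := s) (hs.imp_right And.right)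
  rw [funext (integrand_eq α β γ z θ)]
  exact ((h.const_mul _).fun_div (by fun_prop)
    (sin_pi_mul_ne_zero (ne_int_of_mem_slitDomain hs))).differentiableWithinAt

/-- In the strip of width `2` around the pole `-(k + 1)` the integrand is
`q(s) / (s + k + 1)` with `q` holomorphic, and `q(-(k + 1))` is the term of index `k + 1`
of the series. -/
lemma exists_integrand_eq_div {α β : ℝ} (hα : 0 < α) (hβ : 0 < β) (γ : ℝ) {z : ℂ} (hz : z ≠ 0)
    {θ : ℝ} (hθ : -z = (‖z‖ : ℂ) * Complex.exp (Complex.I * (θ : ℂ))) (k : ℕ) :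
    ∃ q : ℂ → ℂ,
      DifferentiableOn ℂ q {s : ℂ | -((k : ℝ) + 1) - 1 < s.re ∧ s.re < -((k : ℝ) + 1) + 1} ∧
      (∀ s : ℂ, -((k : ℝ) + 1) - 1 < s.re ∧ s.re < -((k : ℝ) + 1) + 1 → s ≠ -((k : ℂ) + 1) →
        integrand α β γ z θ s = q s / (s - -((k : ℂ) + 1))) ∧
      q (-((k : ℂ) + 1)) = term α β γ z (k + 1) := by
  set T : Set ℂ := {s : ℂ | -((k : ℝ) + 1) - 1 < s.re ∧ s.re < -((k : ℝ) + 1) + 1} with hT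
  set a : ℂ := -((k : ℂ) + 1) with ha
  -- `dslope S a` is `sin (π s) / (s - a)` with the singularity at the zero `a` removed.
  let S : ℂ → ℂ := fun s => Complex.sin (Real.pi * s)
  have haT : a ∈ T := by
    simp only [hT, ha, Set.mem_ofPred_eq, Complex.neg_re, Complex.add_re, Complex.natCast_re,
      Complex.one_re]
    constructor <;> linarith
  have hnb : T ∈ 𝓝 a := (isOpen_strip _ _).mem_nhds haT
  have hSa : S a = 0 := by
    have : (Real.pi : ℂ) * a = ((-((k : ℤ) + 1) : ℤ) : ℂ) * Real.pi := by
      rw [ha]; push_cast; ring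
    simp only [S]
    rw [this, Complex.sin_int_mul_pi]
  have hS' : HasDerivAt S (Real.pi * (-1) ^ (k + 1)) a := by
    have h1 : HasDerivAt S (Complex.cos (Real.pi * a) * Real.pi) a := by
      simpa using ((hasDerivAt_id a).const_mul (Real.pi : ℂ)).csin
    have h2 : Complex.cos (Real.pi * a) = (-1) ^ (k + 1) := by
      have : (Real.pi : ℂ) * a = -(((k + 1 : ℕ) : ℂ) * Real.pi) := by
        rw [ha]; push_cast; ring
      rw [this, Complex.cos_neg]
      exact_mod_cast congrArg Complex.ofReal (Real.cos_nat_mul_pi (k + 1))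
    rwa [h2, mul_comm] at h1
  have hdS : DifferentiableOn ℂ (dslope S a) T :=
    (Complex.differentiableOn_dslope hnb).2 fun s _ => by
      simp only [S]; exact DifferentiableAt.differentiableWithinAt (by fun_prop)
  have hpi : (Real.pi : ℂ) ≠ 0 := Complex.ofReal_ne_zero.2 Real.pi_ne_zero
  have hdSa : dslope S a a = Real.pi * (-1) ^ (k + 1) := by rw [dslope_same, hS'.deriv]
  have hdSne : ∀ s ≠ a, dslope S a s = S s / (s - a) := fun s hs => by
    rw [dslope_of_ne _ hs, slope_def_field, hSa, sub_zero]
  have hS0 : ∀ s ∈ T, s ≠ a → S s ≠ 0 := fun s hs hne =>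
    sin_pi_mul_ne_zero (ne_int_of_mem_strip (m := -((k : ℤ) + 1))
      (by push_cast; exact hs) (by push_cast; exact hne))
  have hd0 : ∀ s ∈ T, dslope S a s ≠ 0 := by
    intro s hs
    rcases eq_or_ne s a with rfl | hne
    · rw [hdSa]; exact mul_ne_zero hpi (pow_ne_zero _ (by norm_num))
    · rw [hdSne s hne]; exact div_ne_zero (hS0 s hs hne) (sub_ne_zero.2 hne)
  refine ⟨fun s => Real.pi * holoFactor α β γ z θ s / dslope S a s, ?_, ?_, ?_⟩
  · intro s hs
    have hre : s.re < 0 := by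
      have := hs.2; have hk : (0 : ℝ) ≤ k := k.cast_nonneg; linarith
    exact (((differentiableAt_holoFactor hα hβ γ z θ
      (Or.inr hre)).differentiableWithinAt.const_mul _).fun_div (hdS s hs) (hd0 s hs))
  · intro s hs hne
    have h1 := hS0 s hs hne
    have h2 := sub_ne_zero.2 hne
    simp only [integrand_eq, hdSne s hne]
    change _ / S s = _
    field_simp
  · have h := holoFactor_neg_nat hα hβ γ hz hθ (k + 1)
    have ha' : a = -((k + 1 : ℕ) : ℂ) := by rw [ha]; push_cast; ring
    simp only [hdSa]
    rw [ha', h]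
    have : ((-1 : ℂ)) ^ (k + 1) ≠ 0 := pow_ne_zero _ (by norm_num)
    field_simp

lemma hasResidueAt_integrand {α β : ℝ} (hα : 0 < α) (hβ : 0 < β) (γ : ℝ) {z : ℂ} (hz : z ≠ 0)
    {θ : ℝ} (hθ : -z = (‖z‖ : ℂ) * Complex.exp (Complex.I * (θ : ℂ))) (k : ℕ) :
    HasResidueAt (integrand α β γ z θ) (-((k : ℂ) + 1)) (term α β γ z (k + 1)) := by
  obtain ⟨q, hq, hqf, hqa⟩ := exists_integrand_eq_div hα hβ γ hz hθ k
  set T : Set ℂ := {s : ℂ | -((k : ℝ) + 1) - 1 < s.re ∧ s.re < -((k : ℝ) + 1) + 1} with hT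
  set a : ℂ := -((k : ℂ) + 1) with ha
  have hTo : IsOpen T := isOpen_strip _ _
  have haT : a ∈ T := by
    simp only [hT, ha, Set.mem_ofPred_eq, Complex.neg_re, Complex.add_re, Complex.natCast_re,
      Complex.one_re]
    constructor <;> linarith
  constructor
  · filter_upwards [nhdsWithin_le_nhds (hTo.mem_nhds haT), self_mem_nhdsWithin] with s hs hne
    have hne : s ≠ a := hne
    have h1 : DifferentiableAt ℂ (fun s => q s / (s - a)) s :=
      (hq.differentiableAt (hTo.mem_nhds hs)).fun_div (by fun_prop) (sub_ne_zero.2 hne)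
    refine h1.congr_of_eventuallyEq ?_
    filter_upwards [hTo.mem_nhds hs, isOpen_ne.mem_nhds hne] with u hu hu' using hqf u hu hu'
  · obtain ⟨ε, hε, hball⟩ := Metric.isOpen_iff.1 hTo a haT
    filter_upwards [Ioo_mem_nhdsGT hε] with ρ hρ
    have hsub : Metric.closedBall a ρ ⊆ T :=
      (Metric.closedBall_subset_ball hρ.2).trans hball
    have h := (hq.mono hsub).circleIntegral_sub_inv_smul (Metric.mem_ball_self hρ.1)
    have hc : (∮ s in C(a, ρ), integrand α β γ z θ s) = ∮ s in C(a, ρ), (s - a)⁻¹ • q s := by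
      refine circleIntegral.integral_congr hρ.1.le fun s hs => ?_
      have hne : s ≠ a := by
        rintro rfl; simp at hs; linarith [hρ.1]
      rw [hqf s (hsub (Metric.sphere_subset_closedBall hs)) hne, smul_eq_mul, div_eq_inv_mul]
    rw [hc, h, hqa, smul_eq_mul, one_div, inv_mul_cancel_left₀ Complex.two_pi_I_ne_zero]

/-! ### Decay of the integrand -/

lemma exists_norm_integrand_le {α γ : ℝ} (hα : 0 < α) (hγ : 0 < γ) {β : ℝ} (hβ : 0 < β) (z : ℂ)
    (θ H : ℝ) {δ : ℝ} (hδ : 0 < δ) : ∃ C X : ℝ, ∀ s : ℂ, s.re ≤ -X → |s.im| ≤ H →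
      δ ≤ ‖Complex.sin (Real.pi * s)‖ → ‖integrand α β γ z θ s‖ ≤ C * Real.exp s.re := by
  obtain ⟨C, X, h⟩ := exists_norm_holoFactor_le hα hγ hβ z θ H
  refine ⟨Real.pi * C / δ, X, fun s hs him hsin => ?_⟩
  have h1 := h s hs him
  rw [integrand_eq, norm_div, norm_mul, Complex.norm_real, Real.norm_eq_abs,
    abs_of_pos Real.pi_pos]
  calc _ ≤ Real.pi * (C * Real.exp s.re) / δ := by
        have := (norm_nonneg _).trans h1
        gcongr
    _ = _ := by ring

lemma summable_term {α γ : ℝ} (hα : 0 < α) (hγ : 0 < γ) {β : ℝ} (hβ : 0 < β) {z : ℂ}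
    (hz : z ≠ 0) {θ : ℝ} (hθ : -z = (‖z‖ : ℂ) * Complex.exp (Complex.I * (θ : ℂ))) :
    Summable (term α β γ z) := by
  obtain ⟨C, X, h⟩ := exists_norm_holoFactor_le hα hγ hβ z θ 0
  refine Summable.of_norm_bounded_eventually_nat (g := fun k : ℕ => C * Real.exp (-k))
    (Real.summable_exp_neg_nat.mul_left C) ?_
  filter_upwards [eventually_ge_atTop ⌈X⌉₊] with k hk
  have hk : X ≤ k := Nat.ceil_le.1 hk
  have h1 := h (-(k : ℂ)) (by simpa using hk) (by simp)
  rw [holoFactor_neg_nat hα hβ γ hz hθ] at h1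
  simpa using h1

lemma tendsto_neg_natCast_sub_half : Tendsto (fun n : ℕ => -(n : ℝ) - 1 / 2) atTop atBot := by
  simpa [sub_eq_add_neg] using tendsto_atBot_add_const_right _ (-(1 / 2 : ℝ))
    (tendsto_neg_atTop_atBot.comp (tendsto_natCast_atTop_atTop (R := ℝ)))

lemma tendsto_verticalIntegral {α γ : ℝ} (hα : 0 < α) (hγ : 0 < γ) {β : ℝ} (hβ : 0 < β) (z : ℂ)
    (θ φ₁ φ₂ : ℝ) :
    Tendsto (fun n : ℕ => verticalIntegral (integrand α β γ z θ) φ₁ φ₂ (-n - 1 / 2)) atTop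
      (𝓝 0) := by
  obtain ⟨C, X, h⟩ := exists_norm_integrand_le hα hγ hβ z θ (max |φ₁| |φ₂|) one_pos
  have hlim : Tendsto (fun n : ℕ => C * Real.exp (-(n : ℝ) - 1 / 2) * |φ₂ - φ₁|) atTop (𝓝 0) := by
    simpa using ((Real.tendsto_exp_atBot.comp
      tendsto_neg_natCast_sub_half).const_mul C).mul_const |φ₂ - φ₁|
  refine squeeze_zero_norm' ?_ hlim
  filter_upwards [eventually_ge_atTop ⌈X⌉₊] with n hn
  have hn : X ≤ n := Nat.ceil_le.1 hn
  refine intervalIntegral.norm_integral_le_of_norm_le_const fun y hy => ?_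
  have hre : (((-n - 1 / 2 : ℝ) : ℂ) + y * Complex.I).re = -n - 1 / 2 := by simp
  have him : (((-n - 1 / 2 : ℝ) : ℂ) + y * Complex.I).im = y := by simp
  have hy' : |y| ≤ max |φ₁| |φ₂| := by
    have hy := Set.uIoc_subset_uIcc hy
    rw [Set.uIcc, Set.mem_Icc] at hy
    rw [abs_le]
    constructor
    · refine le_trans ?_ hy.1
      rw [le_min_iff]
      exact ⟨(neg_le_neg (le_max_left _ _)).trans (neg_abs_le _),
        (neg_le_neg (le_max_right _ _)).trans (neg_abs_le _)⟩
    · exact hy.2.trans (max_le_max (le_abs_self _) (le_abs_self _))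
  have h1 := h _ (by rw [hre]; linarith) (by rwa [him])
    (one_le_norm_sin_half_integer n hre)
  rw [hre] at h1
  simpa using h1

/-! ### The integral along a left loop -/

lemma IsLeftLoop.mem_slitDomain {c φ₁ φ₂ : ℝ} {ζ : ℝ → ℂ} (hζ : IsLeftLoop c φ₁ φ₂ ζ)
    (hc : -1 < c) (hc' : c < 0) (t : ℝ) : ζ t ∈ slitDomain := by
  by_cases h : (ζ t).im = 0
  · rw [hζ.crosses_only t h]
    exact Or.inr (by simpa using ⟨hc, hc'⟩)
  · exact Or.inl h

lemma IsLeftLoop.intervalIntegrable {c φ₁ φ₂ : ℝ} {ζ : ℝ → ℂ} (hζ : IsLeftLoop c φ₁ φ₂ ζ)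
    (hc : -1 < c) (hc' : c < 0) {f : ℂ → ℂ} (hf : ContinuousOn f slitDomain) (a b : ℝ) :
    IntervalIntegrable (fun t => f (ζ t) * deriv ζ t) volume a b :=
  (hζ.integrable a b).continuousOn_mul
    (hf.comp_continuous hζ.continuous (hζ.mem_slitDomain hc hc')).continuousOn

lemma IsLeftLoop.integral_eq_sub {c φ₁ φ₂ : ℝ} {ζ : ℝ → ℂ} (hζ : IsLeftLoop c φ₁ φ₂ ζ)
    (hc : -1 < c) (hc' : c < 0) {f P : ℂ → ℂ} (hf : ContinuousOn f slitDomain)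
    (hP : ∀ s ∈ slitDomain, HasDerivAt P (f s) s) (a b : ℝ) :
    ∫ t in a..b, f (ζ t) * deriv ζ t = P (ζ b) - P (ζ a) := by
  obtain ⟨S, hS, hd⟩ := hζ.differentiable
  have hmem := hζ.mem_slitDomain hc hc'
  refine MeasureTheory.integral_eq_of_hasDerivAt_off_countable (fun t => P (ζ t)) _ hS
    (fun t _ => ?_) (fun t ht => ?_) (hζ.intervalIntegrable hc hc' hf a b)
  · exact ((hP _ (hmem t)).continuousAt.comp hζ.continuous.continuousAt).continuousWithinAt
  · exact (hP _ (hmem t)).comp t (hd t ht.2).hasDerivAt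

/-- A primitive of the integrand has a limit at `-∞ + iφ` for `φ ≠ 0`. -/
lemma exists_tendsto_primitive {α γ : ℝ} (hα : 0 < α) (hγ : 0 < γ) {β : ℝ} (hβ : 0 < β) {z : ℂ}
    {θ : ℝ} {P : ℂ → ℂ} (hP : ∀ s ∈ slitDomain, HasDerivAt P (integrand α β γ z θ s) s) {φ : ℝ}
    (hφ : φ ≠ 0) :
    ∃ l : ℂ, Tendsto P (comap Complex.re atBot ⊓ comap Complex.im (𝓝 φ)) (𝓝 l) := by
  have hφ' : 0 < |φ| := abs_pos.2 hφ
  obtain ⟨C, X, h⟩ := exists_norm_integrand_le hα hγ hβ z θ (2 * |φ|)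
    (show 0 < |φ| / 2 by linarith)
  have hband : ∀ s : ℂ, φ - |φ| / 2 < s.im ∧ s.im < φ + |φ| / 2 →
      |φ| / 2 ≤ |s.im| ∧ |s.im| ≤ 2 * |φ| := by
    intro s hs
    have h1 : |s.im - φ| ≤ |φ| / 2 := abs_le.2 ⟨by linarith [hs.1], by linarith [hs.2]⟩
    have h2 := abs_sub_abs_le_abs_sub s.im φ
    have h3 := abs_sub_abs_le_abs_sub φ s.im
    rw [abs_sub_comm] at h3
    constructor <;> linarith
  refine exists_tendsto_of_norm_deriv_le_exp (f := integrand α β γ z θ) (y₁ := φ - |φ| / 2)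
    (y₂ := φ + |φ| / 2) (X := X) (C := C) (by linarith) (by linarith) (fun s _ hs => ?_)
    fun s hre hs => h s hre (hband s hs).2 (le_norm_sin_of_le_abs_im (hband s hs).1)
  exact hP s (Or.inl (abs_pos.1 (by linarith [(hband s hs).1])))

/-- Partial sums of the series as differences of values of a primitive at `re s = -N - 1/2`,
corrected by the vertical integral there: both sides vanish for `N = 0`, and passing from
`N` to `N + 1` crosses the pole `-(N + 1)`. -/
lemma sum_term_eq {α β : ℝ} (hα : 0 < α) (hβ : 0 < β) (γ : ℝ) {z : ℂ}
    (hz : z ≠ 0) {θ : ℝ} (hθ : -z = (‖z‖ : ℂ) * Complex.exp (Complex.I * (θ : ℂ))) {φ₁ φ₂ : ℝ}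
    (hφ₁ : φ₁ < 0) (hφ₂ : 0 < φ₂) {P : ℂ → ℂ}
    (hP : ∀ s ∈ slitDomain, HasDerivAt P (integrand α β γ z θ s) s) (N : ℕ) :
    2 * Real.pi * Complex.I * ∑ k ∈ Finset.range N, term α β γ z (k + 1) =
      P (((-N - 1 / 2 : ℝ) : ℂ) + φ₂ * Complex.I) - P (((-N - 1 / 2 : ℝ) : ℂ) + φ₁ * Complex.I) -
        verticalIntegral (integrand α β γ z θ) φ₁ φ₂ (-N - 1 / 2) := by
  induction N with
  | zero =>
    rw [verticalIntegral_eq_sub (F := P) (a := -1) (b := 0) φ₁ φ₂ (by norm_num)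
      ((differentiableOn_integrand hα hβ γ z θ).continuousOn.mono fun s hs => Or.inr hs)
      fun s hs => hP s (Or.inr hs)]
    simp
  | succ N ih =>
    obtain ⟨q, hq, hqf, hqa⟩ := exists_integrand_eq_div hα hβ γ hz hθ N
    have hcast : ((-((N : ℝ) + 1) : ℝ) : ℂ) = -((N : ℂ) + 1) := by push_cast; ring
    have h := residue_jump (f := integrand α β γ z θ) (q := q) (P := P) (a := -((N : ℝ) + 1))
      (x₀ := -N - 1 / 2) (x₁ := -(N + 1 : ℕ) - 1 / 2) hφ₁ hφ₂
      ⟨by linarith, by linarith⟩ ⟨by push_cast; linarith, by push_cast; linarith⟩ hq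
      (fun s hs hne => by rw [hcast] at hne ⊢; exact hqf s hs hne) (fun s hs => hP s (Or.inl hs))
    rw [hcast, hqa] at h
    rw [Finset.sum_range_succ, mul_add, ih, ← h]
    ring

end LeRoy
end

theorem mainTheorem2 (α β γ : ℝ) (hα : 0 < α) (hβ : 0 < β) (hγ : 0 < γ)
    (z : ℂ) (hz : z ≠ 0)
    (θ : ℝ) (hθ : -z = (‖z‖ : ℂ) * Complex.exp (Complex.I * (θ : ℂ)))
    (c φ₁ φ₂ : ℝ) (hc : -1 < c) (hc' : c < 0) (hφ₁ : φ₁ < 0) (hφ₂ : 0 < φ₂)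
    (ζ : ℝ → ℂ) (hζ : LeRoy.IsLeftLoop c φ₁ φ₂ ζ) :
    Summable (LeRoy.term α β γ z) ∧
    ∃ J : ℂ, LeRoy.HasCurveIntegral (LeRoy.integrand α β γ z θ) ζ J ∧
      LeRoy.F α β γ z =
        1 / (2 * Real.pi * Complex.I) * J + 1 / ((Real.Gamma β ^ γ : ℝ) : ℂ) ∧
      ∃ R : ℕ → ℂ,
        (∀ k : ℕ, LeRoy.HasResidueAt (LeRoy.integrand α β γ z θ) (-((k : ℂ) + 1)) (R k)) ∧
        HasSum R (1 / (2 * Real.pi * Complex.I) * J) := by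
  have hsum := LeRoy.summable_term hα hγ hβ hz hθ
  have hdiff := LeRoy.differentiableOn_integrand hα hβ γ z θ
  obtain ⟨P, hP⟩ := LeRoy.exists_primitive_slitDomain hdiff
  obtain ⟨l₁, hl₁⟩ := LeRoy.exists_tendsto_primitive hα hγ hβ hP hφ₁.ne
  obtain ⟨l₂, hl₂⟩ := LeRoy.exists_tendsto_primitive hα hγ hβ hP hφ₂.ne'
  -- The partial sums, computed from `P` at the abscissas `-N - 1/2`, converge to `l₂ - l₁`.
  have hJ : HasSum (fun k => LeRoy.term α β γ z (k + 1))
      (1 / (2 * Real.pi * Complex.I) * (l₂ - l₁)) := by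
    have hs : Summable fun k => LeRoy.term α β γ z (k + 1) := (summable_nat_add_iff 1).2 hsum
    have hpt : ∀ φ : ℝ, Tendsto (fun n : ℕ => ((-n - 1 / 2 : ℝ) : ℂ) + φ * Complex.I) atTop
        (comap Complex.re atBot ⊓ comap Complex.im (𝓝 φ)) := by
      intro φ
      refine tendsto_inf.2 ⟨tendsto_comap_iff.2 ?_, tendsto_comap_iff.2 ?_⟩
      · refine LeRoy.tendsto_neg_natCast_sub_half.congr fun n => ?_
        simp
      · refine tendsto_const_nhds.congr fun n => ?_
        simp
    have hlim := (((hl₂.comp (hpt φ₂)).sub (hl₁.comp (hpt φ₁))).sub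
      (LeRoy.tendsto_verticalIntegral hα hγ hβ z θ φ₁ φ₂)).congr fun N =>
        (LeRoy.sum_term_eq hα hβ γ hz hθ hφ₁ hφ₂ hP N).symm
    have heq := tendsto_nhds_unique hlim (hs.hasSum.tendsto_sum_nat.const_mul _)
    rw [sub_zero] at heq
    rw [heq, one_div, inv_mul_cancel_left₀ Complex.two_pi_I_ne_zero]
    exact hs.hasSum
  refine ⟨hsum, l₂ - l₁, ⟨hζ.intervalIntegrable hc hc' hdiff.continuousOn, ?_⟩, ?_,
    fun k => LeRoy.term α β γ z (k + 1), LeRoy.hasResidueAt_integrand hα hβ γ hz hθ, hJ⟩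
  -- The ends of the loop tend to `-∞ + iφ₁` and `-∞ + iφ₂`, where `P` has the limits `l₁`, `l₂`.
  · have h₂ : Tendsto ζ atTop (comap Complex.re atBot ⊓ comap Complex.im (𝓝 φ₂)) :=
      tendsto_inf.2 ⟨tendsto_comap_iff.2 hζ.re_end, tendsto_comap_iff.2 hζ.im_end⟩
    have h₁ : Tendsto ζ atBot (comap Complex.re atBot ⊓ comap Complex.im (𝓝 φ₁)) :=
      tendsto_inf.2 ⟨tendsto_comap_iff.2 hζ.re_start, tendsto_comap_iff.2 hζ.im_start⟩
    refine (((hl₂.comp h₂).comp tendsto_snd).sub ((hl₁.comp h₁).comp tendsto_fst)).congr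
      fun p => ?_
    exact (hζ.integral_eq_sub hc hc' hdiff.continuousOn hP p.1 p.2).symm
  · rw [LeRoy.F, hsum.tsum_eq_zero_add, hJ.tsum_eq, add_comm]
    simp [LeRoy.term]
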